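/- Let $G$ be a compact (Hausdorff) topological group with identity $e$, and let $(p_t(x,\cdot))_{t\ge 0,\,x\in G}$ be transition probabilities on $G$: each $p_t(x,\cdot)$ is a regular Borel probability measure (regularity is automatic when $G$ is second countable, e.g. a Lie group), $x\mapsto p_t(x,A)$ is Borel measurable for every Borel set $A$, $p_0(x,\cdot)=\delta_x$, and $p_{s+t}(x,A)=\int_G p_t(y,A)\,p_s(x,dy)$. Assume that $T_tf(x)=\int_G f(y)\,p_t(x,dy)$ defines a Feller semigroup, i.e. $T_t(C(G))\subseteq C(G)$ for all $t\ge 0$ and $\lim_{t\to 0}\|T_tf-f\|_\infty=0$ for all $f\in C(G)$. For an irreducible (continuous, finite-dimensional, matrix-valued) unitary representation $\pi$ of $G$ and $g\in G$, let $$\sigma_t(g,\pi)=\pi(g^{-1})\,(T_t\pi)(g)$$ be the symbol of $T_t$, where $T_t$ acts on the matrix-valued function $\pi$ entry by entry. Then the following are equivalent: 1. $\sigma_{s+t}(e,\pi)=\sigma_s(e,\pi)\,\sigma_t(e,\pi)$ for all $s,t\ge 0$ and all irreducible unitary representations $\pi$ of $G$; 2. $(p_t(e,\cdot),\,t\ge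 0)$ is a vaguely continuous convolution semigroup of probability measures on $G$, i.e., writing $\mu_t=p_t(e,\cdot)$, each $\mu_t$ is a regular Borel probability measure, $\mu_0=\delta_e$, $\mu_{s+t}=\mu_s*\mu_t$ for all $s,t\ge 0$, and $t\mapsto\int_G f\,d\mu_t$ is continuous on $[0,\infty)$ for every $f\in C(G)$. Here $\mu*\nu$ is given by $\int_G f\,d(\mu*\nu)=\int_G\int_G f(\rho\tau)\,\mu(d\rho)\,\nu(d\tau)$ for all bounded Borel functions $f$ on $G$. -/

import Mathlib

open MeasureTheory ProbabilityTheory Filter Topology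
open scoped NNReal ENNReal ZeroAtInfty

/-- The operator `f ↦ (x ↦ ∫ f(y) P(x, dy))` defined by a transition kernel `P`, acting on
real or complex valued functions. -/
noncomputable def transitionOperator {E : Type*} [MeasurableSpace E] {𝕜 : Type*} [RCLike 𝕜]
    (P : Kernel E E) (f : E → 𝕜) : E → 𝕜 :=
  fun x => ∫ y, f y ∂(P x)

/-- The transition probabilities `p t x = p_t(x, ·)`, `t ≥ 0`, on a locally compact space `E`
form a conservative time-homogeneous Markov transition function whose semigroup
`T_t f(x) = ∫ f(y) p_t(x, dy)` is a Feller semigroup. Measurability of `x ↦ p_t(x, A)` is part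
of `Kernel`. -/
structure IsFeller {E : Type*} [TopologicalSpace E] [MeasurableSpace E] [BorelSpace E]
    (p : ℝ≥0 → Kernel E E) : Prop where
  /-- `p_t(x, ·)` is a probability measure. -/
  isProbabilityMeasure : ∀ t x, IsProbabilityMeasure (p t x)
  /-- `p_t(x, ·)` is a regular Borel measure (automatic if `E` is second countable). -/
  regular : ∀ t x, (p t x).Regular
  /-- `p_0(x, ·) = δ_x`, that is `T_0 = I`. -/
  zero : ∀ x, p 0 x = Measure.dirac x
  /-- The Chapman-Kolmogorov equations, that is `T_{s+t} = T_s T_t`. -/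
  chapman_kolmogorov : ∀ s t x (A : Set E), MeasurableSet A →
    p (s + t) x A = ∫⁻ y, p t y A ∂(p s x)
  /-- `T_t` maps `C₀(E)` to `C₀(E)`. -/
  map_zeroAtInfty : ∀ t (f : C₀(E, ℝ)), ∃ h : C₀(E, ℝ), ⇑h = transitionOperator (p t) ⇑f
  /-- `‖T_t f - f‖_∞ → 0` as `t → 0`, for each `f ∈ C₀(E)`. -/
  tendsto_zero : ∀ f : C₀(E, ℝ),
    TendstoUniformly (fun (t : ℝ≥0) => transitionOperator (p t) ⇑f) (⇑f) (𝓝[>] 0)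

/-- A continuous homomorphism from `G` to the unitary `d × d` matrices which is irreducible as a
representation on `ℂ^d`. -/
structure IrreducibleUnitaryRep (G : Type*) [Group G] [TopologicalSpace G] where
  /-- The dimension of the representation space. -/
  dim : ℕ
  /-- The matrices of the representation. -/
  toHom : G →* Matrix.unitaryGroup (Fin dim) ℂ
  continuous_toHom : Continuous toHom
  irreducible : Representation.IsIrreducible
    (((Matrix.toLinAlgEquiv' : Matrix (Fin dim) (Fin dim) ℂ ≃ₐ[ℂ] _) :
        Matrix (Fin dim) (Fin dim) ℂ →* ((Fin dim → ℂ) →ₗ[ℂ] (Fin dim → ℂ))).comp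
      ((Matrix.unitaryGroup (Fin dim) ℂ).subtype.comp toHom) :
      Representation ℂ G (Fin dim → ℂ))

/-- The matrix `π(g)`. -/
def IrreducibleUnitaryRep.matrix {G : Type*} [Group G] [TopologicalSpace G]
    (π : IrreducibleUnitaryRep G) (g : G) : Matrix (Fin π.dim) (Fin π.dim) ℂ :=
  (π.toHom g : Matrix (Fin π.dim) (Fin π.dim) ℂ)

/-- The symbol `σ_A(g, π) = π(g⁻¹) (A π)(g)` of an operator `A` on functions on `G`, where `A` acts
on the matrix valued function `π` entry by entry. -/
def symbol {G : Type*} [Group G] [TopologicalSpace G] (A : (G → ℂ) → (G → ℂ))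
    (g : G) (π : IrreducibleUnitaryRep G) : Matrix (Fin π.dim) (Fin π.dim) ℂ :=
  π.matrix g⁻¹ * Matrix.of fun i j => A (fun x => π.matrix x i j) g

/-- `κ = μ * ν` in the sense that `∫ f(ρ) κ(dρ) = ∫ ∫ f(ρτ) μ(dρ) ν(dτ)` for all bounded Borel
functions `f`. -/
def IsConvolution {G : Type*} [Group G] [MeasurableSpace G] (κ μ ν : Measure G) : Prop :=
  ∀ f : G → ℝ, Measurable f → (∃ C : ℝ, ∀ x, |f x| ≤ C) →
    ∫ ρ, f ρ ∂κ = ∫ τ, ∫ ρ, f (ρ * τ) ∂μ ∂ν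

/-- `(μ_t, t ≥ 0)` is a vaguely continuous convolution semigroup of (regular Borel) probability
measures on `G`. -/
structure IsConvolutionSemigroup {G : Type*} [Group G] [TopologicalSpace G] [MeasurableSpace G]
    [BorelSpace G] (μ : ℝ≥0 → Measure G) : Prop where
  isProbabilityMeasure : ∀ t, IsProbabilityMeasure (μ t)
  regular : ∀ t, (μ t).Regular
  zero : μ 0 = Measure.dirac 1
  add : ∀ s t, IsConvolution (μ (s + t)) (μ s) (μ t)
  vaguely_continuous : ∀ f : G → ℝ, Continuous f → HasCompactSupport f →
    Continuous fun t => ∫ x, f x ∂(μ t)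

/-! Write `μ_t` for `p t 1`. Since `π(e) = 1`, the symbol at `e` is the matrix `∫ π dμ_t`, the
Fourier transform of `μ_t`. As `π` is multiplicative, the product of the symbols for `s` and `t` is
`∫ ∫ π(ρτ) μ_s(dρ) μ_t(dτ)`. So condition 1 says exactly that `μ_{s+t}` and `μ_s * μ_t` agree on
matrix coefficients. The remaining clauses of condition 2 follow from the Feller property alone.

Peter-Weyl (`topologicalClosure_span_matrixCoefficients`) extends the agreement to all continuous
functions. It rests on convolution by a symmetric continuous function, which is a compact
self-adjoint operator on `L²` commuting with right translations. Its eigenspaces for nonzero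
eigenvalues therefore yield finite-dimensional invariant spaces of continuous functions, and these
split into irreducible pieces made of matrix coefficients. Approximate identities then reach every
continuous function.

Passing on to bounded Borel functions (`isConvolution_of_continuous`) takes care because `G` need
not be second countable: the convolution is built from a kernel, and its regularity is not known
beforehand. It is bounded by the regular measure on open sets, hence on all Borel sets, and equal
total mass forces equality. -/

/-- The right translation `u ↦ (x ↦ u (x * g))` of continuous functions on a group. -/
noncomputable def rightTranslate {G : Type*} [Group G] [TopologicalSpace G]
    [IsTopologicalGroup G] (g : G) : C(G, ℂ) →ₗ[ℂ] C(G, ℂ) where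
  toFun u := ⟨fun x => u (x * g), by fun_prop⟩
  map_add' _ _ := rfl
  map_smul' _ _ := rfl

/-- The matrix coefficients of the irreducible unitary representations of `G`. -/
def matrixCoefficients (G : Type*) [Group G] [TopologicalSpace G] : Set C(G, ℂ) :=
  {f | ∃ (π : IrreducibleUnitaryRep G) (i j : Fin π.dim), ∀ x, f x = π.matrix x i j}

/-- A finite-dimensional space of continuous functions has a basis orthonormal in `L²`. -/
lemma exists_orthonormal_expansion {X : Type*} [TopologicalSpace X] [CompactSpace X]
    [MeasurableSpace X] [BorelSpace X] (μ : Measure X) [IsFiniteMeasure μ] [μ.IsOpenPosMeasure]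
    (V : Submodule ℂ C(X, ℂ)) [FiniteDimensional ℂ V] :
    ∃ (d : ℕ) (e : Fin d → C(X, ℂ)), (∀ i, e i ∈ V) ∧
      Orthonormal ℂ (fun i => ContinuousMap.toLp 2 μ ℂ (e i)) ∧
      ∀ v ∈ V, v = ∑ i, (inner ℂ (ContinuousMap.toLp 2 μ ℂ (e i))
        (ContinuousMap.toLp 2 μ ℂ v) : ℂ) • e i := by
  let L : C(X, ℂ) →ₗ[ℂ] Lp ℂ 2 μ := (ContinuousMap.toLp 2 μ ℂ).toLinearMap
  let b := stdOrthonormalBasis ℂ (V.map L)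
  have hb : ∀ i, ∃ u ∈ V, L u = b i := fun i => (b i).2
  choose e heV he using hb
  refine ⟨_, e, heV, ?_, fun v hv => ?_⟩
  · have h := b.orthonormal.comp_linearIsometry (V.map L).subtypeₗᵢ
    convert h using 2 with i
    exact he i
  · refine ContinuousMap.toLp_injective μ (p := 2) (𝕜 := ℂ) ?_
    have h := congrArg Subtype.val (b.sum_repr' ⟨L v, v, hv, rfl⟩)
    simp only [Submodule.coe_sum, Submodule.coe_smul, Submodule.coe_inner, ← he] at h
    rw [map_sum]
    simp only [map_smul]
    exact h.symm

/-! ### Finite-dimensional translation invariant spaces of continuous functions. -/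

section RightTranslate

variable {G : Type*} [Group G] [TopologicalSpace G] [IsTopologicalGroup G]

@[simp]
lemma rightTranslate_apply (g : G) (u : C(G, ℂ)) (x : G) :
    rightTranslate g u x = u (x * g) := rfl

@[simp]
lemma rightTranslate_one (u : C(G, ℂ)) : rightTranslate 1 u = u := by
  ext x; simp

lemma rightTranslate_mul (g h : G) (u : C(G, ℂ)) :
    rightTranslate (g * h) u = rightTranslate g (rightTranslate h u) := by
  ext x; simp [mul_assoc]

lemma continuous_rightTranslate (u : C(G, ℂ)) : Continuous fun g : G => rightTranslate g u :=
  (ContinuousMap.curry ⟨fun q : G × G => u (q.2 * q.1), by fun_prop⟩).continuous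

variable [CompactSpace G] [MeasurableSpace G] [BorelSpace G]
  (μ : Measure G) [IsFiniteMeasure μ]

lemma inner_toLp_rightTranslate [μ.IsMulRightInvariant] (g : G) (u v : C(G, ℂ)) :
    inner ℂ (ContinuousMap.toLp 2 μ ℂ (rightTranslate g u))
      (ContinuousMap.toLp 2 μ ℂ (rightTranslate g v)) =
    inner ℂ (ContinuousMap.toLp 2 μ ℂ u) (ContinuousMap.toLp 2 μ ℂ v) := by
  rw [ContinuousMap.inner_toLp, ContinuousMap.inner_toLp]
  exact integral_mul_right_eq_self (fun x => v x * (starRingEnd ℂ) (u x)) g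

/-- A nonzero finite-dimensional space of continuous functions which is minimal among the
right translation invariant ones consists of combinations of matrix coefficients. -/
lemma le_span_matrixCoefficients_of_minimal [μ.IsOpenPosMeasure] [μ.IsMulRightInvariant]
    (V : Submodule ℂ C(G, ℂ)) [FiniteDimensional ℂ V] (hV : V ≠ ⊥)
    (hinv : ∀ g, ∀ v ∈ V, rightTranslate g v ∈ V)
    (hmin : ∀ W ≤ V, (∀ g, ∀ v ∈ W, rightTranslate g v ∈ W) → W = ⊥ ∨ W = V) :
    V ≤ Submodule.span ℂ (matrixCoefficients G) := by
  obtain ⟨d, e, heV, horth, hexp⟩ := exists_orthonormal_expansion μ V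
  obtain ⟨M, hMdef⟩ : ∃ M : G → Matrix (Fin d) (Fin d) ℂ, ∀ g i j, M g i j =
      inner ℂ (ContinuousMap.toLp 2 μ ℂ (e i)) (ContinuousMap.toLp 2 μ ℂ (rightTranslate g (e j))) :=
    ⟨fun g => Matrix.of fun i j => _, fun _ _ _ => rfl⟩
  have hM : ∀ g j, rightTranslate g (e j) = ∑ i, M g i j • e i := fun g j => by
    simp only [hMdef]
    exact hexp _ (hinv g _ (heV j))
  have hMlin : ∀ g (c : Fin d → ℂ), rightTranslate g (∑ j, c j • e j) =
      ∑ i, (M g).mulVec c i • e i := fun g c => by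
    simp only [map_sum, map_smul, hM g, Finset.smul_sum, smul_smul, Matrix.mulVec, dotProduct,
      Finset.sum_smul]
    rw [Finset.sum_comm]
    exact Finset.sum_congr rfl fun i _ => Finset.sum_congr rfl fun j _ => by rw [mul_comm]
  have hcoord : ∀ (c : Fin d → ℂ) i, inner ℂ (ContinuousMap.toLp 2 μ ℂ (e i))
      (ContinuousMap.toLp 2 μ ℂ (∑ j, c j • e j)) = c i := fun c i => by
    simp only [map_sum, map_smul]
    exact horth.inner_right_fintype c i
  have hM1 : M 1 = 1 := by
    ext i j
    rw [hMdef, rightTranslate_one, Matrix.one_apply]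
    exact orthonormal_iff_ite.1 horth i j
  have hMmul : ∀ g h, M (g * h) = M g * M h := fun g h => by
    ext i j
    rw [hMdef, rightTranslate_mul, hM h j, hMlin, hcoord]
    rfl
  have hMunit : ∀ g, star (M g) * M g = 1 := fun g => by
    ext i j
    have h := inner_toLp_rightTranslate μ g (e i) (e j)
    rw [hM g i, hM g j] at h
    simp only [map_sum, map_smul] at h
    rw [horth.inner_sum, orthonormal_iff_ite.1 horth i j] at h
    rw [Matrix.mul_apply, Matrix.one_apply, ← h]
    rfl
  have hMcont : Continuous M := continuous_matrix fun i j => by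
    simp only [hMdef]
    exact continuous_const.inner ((ContinuousMap.toLp 2 μ ℂ).continuous.comp
      (continuous_rightTranslate (e j)))
  let ρ : G →* Matrix.unitaryGroup (Fin d) ℂ :=
    { toFun := fun g => ⟨M g, Matrix.mem_unitaryGroup_iff'.2 (hMunit g)⟩
      map_one' := Subtype.ext hM1
      map_mul' := fun g h => Subtype.ext (hMmul g h) }
  let Φ : (Fin d → ℂ) →ₗ[ℂ] C(G, ℂ) := Fintype.linearCombination ℂ e
  have hΦ : ∀ c, Φ c = ∑ i, c i • e i := fun c => Fintype.linearCombination_apply ℂ e c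
  have hΦinj : Function.Injective Φ := fun c c' h => by
    ext i
    rw [← hcoord c i, ← hcoord c' i, ← hΦ, ← hΦ, h]
  have hΦrange : (⊤ : Submodule ℂ (Fin d → ℂ)).map Φ = V := by
    refine le_antisymm ?_ fun v hv => ⟨_, trivial, (hΦ _).trans (hexp v hv).symm⟩
    rintro _ ⟨c, -, rfl⟩
    rw [hΦ]
    exact V.sum_mem fun i _ => V.smul_mem _ (heV i)
  have hΦM : ∀ g c, rightTranslate g (Φ c) = Φ ((M g).mulVec c) := fun g c => by
    rw [hΦ, hΦ, hMlin]
  let π : IrreducibleUnitaryRep G :=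
    { dim := d
      toHom := ρ
      continuous_toHom := Continuous.subtype_mk hMcont _
      irreducible := by
        refine @IsSimpleOrder.mk _ _ _ ⟨⊥, ⊤, fun h => hV ?_⟩ fun σ => ?_
        · have h' : (⊥ : Submodule ℂ (Fin d → ℂ)) = ⊤ :=
            congrArg Subrepresentation.toSubmodule h
          rw [← hΦrange, ← h', Submodule.map_bot]
        · refine (hmin (σ.toSubmodule.map Φ) ?_ ?_).imp (fun h => ?_) fun h => ?_
          · rw [← hΦrange]
            exact Submodule.map_mono le_top
          · rintro g _ ⟨c, hc, rfl⟩
            rw [hΦM]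
            exact ⟨_, σ.apply_mem_toSubmodule g hc, rfl⟩
          · refine Subrepresentation.toSubmodule_injective ?_
            exact Submodule.map_injective_of_injective hΦinj (h.trans (Submodule.map_bot Φ).symm)
          · refine Subrepresentation.toSubmodule_injective ?_
            rw [← hΦrange] at h
            exact Submodule.map_injective_of_injective hΦinj h }
  intro v hv
  let m : Fin d → Fin d → C(G, ℂ) := fun i j => ⟨fun x => M x i j, hMcont.matrix_elem i j⟩
  obtain ⟨c, -, rfl⟩ := hΦrange.ge hv
  -- Evaluating the translate of `v` by `x` at the identity gives `v x`, which brings in the entries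
  -- of `M x`.
  have hv' : Φ c = ∑ i, ∑ j, (c j * e i 1) • m i j := by
    ext x
    have h := congrArg (fun u : C(G, ℂ) => u 1) (hΦM x c)
    simp only [rightTranslate_apply, one_mul] at h
    rw [h, hΦ]
    simp only [ContinuousMap.coe_sum, Finset.sum_apply, ContinuousMap.coe_smul, Pi.smul_apply,
      smul_eq_mul, Matrix.mulVec, dotProduct, Finset.sum_mul, m, ContinuousMap.coe_mk]
    exact Finset.sum_congr rfl fun i _ => Finset.sum_congr rfl fun j _ => by ring
  rw [hv']
  exact Submodule.sum_mem _ fun i _ => Submodule.sum_mem _ fun j _ =>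
    Submodule.smul_mem _ _ (Submodule.subset_span ⟨π, i, j, fun x => rfl⟩)

/-- Every finite-dimensional right translation invariant space of continuous functions consists
of combinations of matrix coefficients. -/
lemma le_span_matrixCoefficients [μ.IsOpenPosMeasure] [μ.IsMulRightInvariant]
    (V : Submodule ℂ C(G, ℂ)) [FiniteDimensional ℂ V]
    (hinv : ∀ g, ∀ v ∈ V, rightTranslate g v ∈ V) :
    V ≤ Submodule.span ℂ (matrixCoefficients G) := by
  induction hn : Module.finrank ℂ V using Nat.strong_induction_on generalizing V with
  | _ n ih =>
  subst hn
  by_cases hV : V = ⊥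
  · simp [hV]
  by_cases hmin : ∀ W ≤ V, (∀ g, ∀ v ∈ W, rightTranslate g v ∈ W) → W = ⊥ ∨ W = V
  · exact le_span_matrixCoefficients_of_minimal μ V hV hinv hmin
  push Not at hmin
  obtain ⟨W, hWV, hWinv, hW0, hW1⟩ := hmin
  have : FiniteDimensional ℂ W := Submodule.finiteDimensional_of_le hWV
  let L : C(G, ℂ) →ₗ[ℂ] Lp ℂ 2 μ := (ContinuousMap.toLp 2 μ ℂ).toLinearMap
  have hL : Function.Injective L := ContinuousMap.toLp_injective μ
  -- The `L²`-orthogonal complement of `W` inside `V`; it is invariant because translations are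
  -- isometries.
  let W' : Submodule ℂ C(G, ℂ) := V ⊓ (W.map L)ᗮ.comap L
  have hW'V : W' ≤ V := inf_le_left
  have : FiniteDimensional ℂ W' := Submodule.finiteDimensional_of_le hW'V
  have hdisj : W ⊓ W' = ⊥ := by
    refine (Submodule.eq_bot_iff _).2 fun w hw => hL ?_
    rw [map_zero, ← inner_self_eq_zero (𝕜 := ℂ)]
    exact (Submodule.mem_orthogonal _ _).1 hw.2.2 _ ⟨w, hw.1, rfl⟩
  have hW'inv : ∀ g, ∀ v ∈ W', rightTranslate g v ∈ W' := fun g v hv => by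
    refine ⟨hinv g v hv.1, (Submodule.mem_orthogonal _ _).2 ?_⟩
    rintro _ ⟨w, hw, rfl⟩
    have h := inner_toLp_rightTranslate μ g (rightTranslate g⁻¹ w) v
    rw [← rightTranslate_mul, mul_inv_cancel, rightTranslate_one] at h
    refine h.trans ?_
    exact (Submodule.mem_orthogonal _ _).1 hv.2 _ ⟨_, hWinv g⁻¹ w hw, rfl⟩
  have hsup : V ≤ W ⊔ W' := fun v hv => by
    obtain ⟨_, ⟨w, hw, rfl⟩, z, hz, hwz⟩ :=
      Submodule.exists_add_mem_mem_orthogonal (K := W.map L) (L v)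
    refine Submodule.mem_sup.2 ⟨w, hw, v - w, ⟨V.sub_mem hv (hWV hw), ?_⟩, by abel⟩
    change L (v - w) ∈ (W.map L)ᗮ
    rwa [map_sub, hwz, add_sub_cancel_left]
  refine hsup.trans (sup_le ?_ ?_)
  · exact ih _ (Submodule.finrank_lt_finrank_of_lt (lt_of_le_of_ne hWV hW1)) W hWinv rfl
  · refine ih _ (Submodule.finrank_lt_finrank_of_lt (lt_of_le_of_ne hW'V fun h => hW0 ?_))
      W' hW'inv rfl
    rw [← hdisj, h, inf_eq_left.2 hWV]

end RightTranslate

/-! ### Compactness of operators with a continuous kernel. -/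

section InnerKernel

variable {X : Type*} [TopologicalSpace X] [CompactSpace X]
  {H : Type*} [NormedAddCommGroup H] [InnerProductSpace ℂ H]

/-- The operator `v ↦ (x ↦ ⟪K x, v⟫)` from a Hilbert space to continuous functions. -/
noncomputable def innerKernelOperator (K : C(X, H)) : H →L[ℂ] C(X, ℂ) :=
  LinearMap.mkContinuous
    { toFun := fun v => ⟨fun x => inner ℂ (K x) v, by fun_prop⟩
      map_add' := fun v w => by ext x; simp
      map_smul' := fun c v => by ext x; simp } ‖K‖ fun v => by
    refine (ContinuousMap.norm_le _ (by positivity)).2 fun x => ?_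
    exact (norm_inner_le_norm _ _).trans
      (mul_le_mul_of_nonneg_right (K.norm_coe_le_norm x) (norm_nonneg v))

/-- Arzelà-Ascoli: by Cauchy-Schwarz the images of the unit ball are bounded by `‖K‖` and share the
modulus of continuity of `K`. -/
lemma isCompactOperator_innerKernelOperator (K : C(X, H)) :
    IsCompactOperator (innerKernelOperator K) := by
  let ι := ContinuousMap.linearIsometryBoundedOfCompact X ℂ ℂ
  let A := (fun v => ι (innerKernelOperator K v)) '' Metric.closedBall 0 1
  have hA : IsCompact (closure A) := by
    refine BoundedContinuousFunction.arzela_ascoli (Metric.closedBall 0 ‖K‖)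
      (isCompact_closedBall _ _) A ?_ fun x₀ => ?_
    · rintro _ x ⟨v, hv, rfl⟩
      rw [mem_closedBall_zero_iff] at hv ⊢
      calc ‖inner ℂ (K x) v‖ ≤ ‖K x‖ * ‖v‖ := norm_inner_le_norm _ _
        _ ≤ ‖K‖ * 1 := by
          gcongr
          exact K.norm_coe_le_norm x
        _ = ‖K‖ := mul_one _
    · rw [Metric.equicontinuousAt_iff_right]
      intro ε hε
      filter_upwards [Metric.tendsto_nhds.1 (K.continuous.tendsto x₀) ε hε] with x hx
      rintro ⟨_, v, hv, rfl⟩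
      rw [mem_closedBall_zero_iff] at hv
      change dist (inner ℂ (K x₀) v) (inner ℂ (K x) v) < ε
      rw [dist_comm, dist_eq_norm, ← inner_sub_left]
      calc ‖inner ℂ (K x - K x₀) v‖ ≤ ‖K x - K x₀‖ * ‖v‖ := norm_inner_le_norm _ _
        _ ≤ ‖K x - K x₀‖ * 1 := by gcongr
        _ < ε := by rwa [mul_one, ← dist_eq_norm]
  rw [isCompactOperator_iff_exists_mem_nhds_image_subset_compact]
  refine ⟨_, Metric.closedBall_mem_nhds 0 one_pos, _, hA.image ι.symm.continuous, ?_⟩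
  rintro _ ⟨v, hv, rfl⟩
  exact ⟨_, subset_closure ⟨v, hv, rfl⟩, ι.symm_apply_apply _⟩

end InnerKernel

/-! ### Convolution operators and the Peter-Weyl theorem. -/

section Convolution

variable {G : Type*} [Group G] [TopologicalSpace G] [IsTopologicalGroup G] [CompactSpace G]
  [MeasurableSpace G] [BorelSpace G] (μ : Measure G) [IsFiniteMeasure μ]

/-- The convolution operator `u ↦ (x ↦ ∫ φ (x * y⁻¹) u y ∂μ)` from `L²` to continuous functions. -/
noncomputable def convolutionOperator (φ : C(G, ℝ)) : Lp ℂ 2 μ →L[ℂ] C(G, ℂ) :=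
  innerKernelOperator ⟨fun x => ContinuousMap.toLp 2 μ ℂ
    (ContinuousMap.curry ⟨fun q : G × G => (φ (q.1 * q.2⁻¹) : ℂ), by fun_prop⟩ x), by fun_prop⟩

lemma convolutionOperator_toLp (φ : C(G, ℝ)) (u : C(G, ℂ)) (x : G) :
    convolutionOperator μ φ (ContinuousMap.toLp 2 μ ℂ u) x =
      ∫ y, u y * (φ (x * y⁻¹) : ℂ) ∂μ := by
  refine (ContinuousMap.inner_toLp μ _ u).trans ?_
  simp

lemma convolutionOperator_rightTranslate [μ.IsMulRightInvariant] (φ : C(G, ℝ)) (u : C(G, ℂ))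
    (g : G) :
    convolutionOperator μ φ (ContinuousMap.toLp 2 μ ℂ (rightTranslate g u)) =
      rightTranslate g (convolutionOperator μ φ (ContinuousMap.toLp 2 μ ℂ u)) := by
  ext x
  rw [rightTranslate_apply, convolutionOperator_toLp, convolutionOperator_toLp,
    ← integral_mul_right_eq_self (fun y => u y * (φ (x * g * y⁻¹) : ℂ)) g]
  simp [mul_assoc]

/-- The convolution operator as an operator on `L²`. -/
noncomputable def convolutionOperatorL2 (φ : C(G, ℝ)) : Lp ℂ 2 μ →L[ℂ] Lp ℂ 2 μ :=
  (ContinuousMap.toLp 2 μ ℂ).comp (convolutionOperator μ φ)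

lemma isCompactOperator_convolutionOperatorL2 (φ : C(G, ℝ)) :
    IsCompactOperator (convolutionOperatorL2 μ φ) :=
  IsCompactOperator.clm_comp (f := convolutionOperator μ φ)
    (isCompactOperator_innerKernelOperator _) (ContinuousMap.toLp 2 μ ℂ)

/-- The kernel `φ (x * y⁻¹)` is real and symmetric in `x` and `y`. By density it suffices to test
continuous functions, for which Fubini holds without second countability. -/
lemma isSymmetric_convolutionOperatorL2 [T2Space G] [μ.WeaklyRegular] (φ : C(G, ℝ))
    (hφ : ∀ x, φ x⁻¹ = φ x) :
    (convolutionOperatorL2 μ φ).toLinearMap.IsSymmetric := by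
  intro f g
  refine (ContinuousMap.toLp_denseRange ℂ μ ℂ (p := 2) (by simp)).induction_on₂ ?_ ?_ f g
  · exact isClosed_eq
      (((convolutionOperatorL2 μ φ).continuous.comp continuous_fst).inner continuous_snd)
      (continuous_fst.inner ((convolutionOperatorL2 μ φ).continuous.comp continuous_snd))
  intro u v
  change inner ℂ (ContinuousMap.toLp 2 μ ℂ
      (convolutionOperator μ φ (ContinuousMap.toLp 2 μ ℂ u))) (ContinuousMap.toLp 2 μ ℂ v) =
    inner ℂ (ContinuousMap.toLp 2 μ ℂ u) (ContinuousMap.toLp 2 μ ℂ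
      (convolutionOperator μ φ (ContinuousMap.toLp 2 μ ℂ v)))
  rw [ContinuousMap.inner_toLp, ContinuousMap.inner_toLp]
  simp only [convolutionOperator_toLp, ← integral_conj, ← integral_const_mul,
    ← integral_mul_const]
  rw [integral_integral_swap_of_hasCompactSupport (by fun_prop)
    (HasCompactSupport.of_compactSpace _)]
  refine integral_congr_ae (.of_forall fun y => integral_congr_ae (.of_forall fun x => ?_))
  have h : φ (x * y⁻¹) = φ (y * x⁻¹) := by rw [← hφ]; simp
  simp only [map_mul, Complex.conj_ofReal, h]
  ring

/-- The range of the convolution operator can be approximated by matrix coefficients. -/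
lemma convolutionOperator_mem_closure [T2Space G] [μ.WeaklyRegular] [μ.IsOpenPosMeasure]
    [μ.IsMulRightInvariant] (φ : C(G, ℝ)) (hφ : ∀ x, φ x⁻¹ = φ x) (f : Lp ℂ 2 μ) :
    convolutionOperator μ φ f ∈ (Submodule.span ℂ (matrixCoefficients G)).topologicalClosure := by
  set T := convolutionOperator μ φ
  have hcomp := isCompactOperator_convolutionOperatorL2 μ φ
  let E : ℂ → Submodule ℂ (Lp ℂ 2 μ) :=
    Module.End.eigenspace (convolutionOperatorL2 μ φ : Lp ℂ 2 μ →ₗ[ℂ] Lp ℂ 2 μ)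
  have hE : (⨆ l, E l).topologicalClosure = ⊤ := by
    rw [Submodule.topologicalClosure_eq_top_iff]
    exact ContinuousLinearMap.orthogonalComplement_iSup_eigenspaces_eq_bot hcomp
      (isSymmetric_convolutionOperatorL2 μ φ hφ)
  have heig : ∀ l, ∀ f ∈ E l, ContinuousMap.toLp 2 μ ℂ (T f) = l • f := fun l f hf =>
    Module.End.mem_eigenspace_iff.1 hf
  have hspan : ⨆ l, E l ≤ (Submodule.span ℂ (matrixCoefficients G)).comap T.toLinearMap := by
    refine iSup_le fun l => ?_
    rw [← Submodule.map_le_iff_le_comap]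
    by_cases hl : l = 0
    · rintro _ ⟨f, hf, rfl⟩
      have h : T f = 0 := by
        refine ContinuousMap.toLp_injective μ (p := 2) (𝕜 := ℂ) ?_
        rw [heig l f hf, hl, zero_smul, map_zero]
      change T f ∈ _
      rw [h]
      exact Submodule.zero_mem _
    -- For `l ≠ 0` an eigenvector `f` has the continuous representative `l⁻¹ • T f`, so it can be
    -- translated pointwise, and `T` commutes with translation.
    · have : FiniteDimensional ℂ (E l) :=
        ContinuousLinearMap.finite_dimensional_eigenspace hcomp l hl
      refine le_span_matrixCoefficients μ _ ?_
      rintro g _ ⟨f, hf, rfl⟩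
      have hf' : f = ContinuousMap.toLp 2 μ ℂ (l⁻¹ • T f) := by
        rw [map_smul, heig l f hf, smul_smul, inv_mul_cancel₀ hl, one_smul]
      have hT : T (ContinuousMap.toLp 2 μ ℂ (rightTranslate g (l⁻¹ • T f))) =
          rightTranslate g (T f) := by
        rw [convolutionOperator_rightTranslate, ← hf']
      refine ⟨_, Module.End.mem_eigenspace_iff.2 ?_, hT⟩
      change ContinuousMap.toLp 2 μ ℂ (T _) = _
      rw [hT, map_smul, map_smul, smul_smul, mul_inv_cancel₀ hl, one_smul]
  have hf : f ∈ (⨆ l, E l).topologicalClosure := hE ▸ trivial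
  exact map_mem_closure T.continuous hf fun w hw => hspan hw

/-- A continuous function is a uniform limit of its convolutions. -/
lemma exists_convolutionOperator_sub_lt [T2Space G] [μ.IsOpenPosMeasure] [μ.IsMulRightInvariant]
    (f : C(G, ℂ)) {ε : ℝ} (hε : 0 < ε) :
    ∃ φ : C(G, ℝ), (∀ x, φ x⁻¹ = φ x) ∧
      ‖convolutionOperator μ φ (ContinuousMap.toLp 2 μ ℂ f) - f‖ ≤ ε := by
  let F : C(G, C(G, ℂ)) := ContinuousMap.curry ⟨fun q : G × G => f (q.1⁻¹ * q.2), by fun_prop⟩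
  have hF : F 1 = f := by ext x; simp [F]
  -- If `x * y⁻¹ ∈ U`, then `f y` is the value of `F (x * y⁻¹)` at `x`, hence within `ε` of `f x`.
  let U : Set G := {g | dist (F g) (F 1) < ε}
  have hU : IsOpen U := isOpen_lt (by fun_prop) continuous_const
  have h1U : (1 : G) ∈ U := by simpa [U] using hε
  obtain ⟨ψ, hψ0, hψ1, hψ⟩ := exists_continuous_zero_one_of_isClosed (X := G) hU.isClosed_compl
    isClosed_singleton (Set.disjoint_singleton_right.2 fun h => h h1U)
  -- The product makes the bump function invariant under inversion and keeps it zero off `U`.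
  let χ : C(G, ℝ) := ⟨fun x => ψ x * ψ x⁻¹, by fun_prop⟩
  have hχ0 : ∀ x, 0 ≤ χ x := fun x => mul_nonneg (hψ x).1 (hψ x⁻¹).1
  have hint : 0 < ∫ x, χ x⁻¹ ∂μ := by
    refine Continuous.integral_pos_of_hasCompactSupport_nonneg_nonzero (x := 1) (by fun_prop)
      (HasCompactSupport.of_compactSpace _) (fun x => hχ0 _) ?_
    have : ψ 1 = 1 := hψ1 rfl
    simp [χ, this]
  set c := ∫ x, χ x⁻¹ ∂μ
  let φ : C(G, ℝ) := c⁻¹ • χ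
  have hφ0 : ∀ x, 0 ≤ φ x := fun x => mul_nonneg (inv_nonneg.2 hint.le) (hχ0 x)
  have hφU : ∀ x, x ∉ U → φ x = 0 := fun x hx => by
    have : ψ x = 0 := hψ0 hx
    simp [φ, χ, this]
  have hφ1 : ∀ x, ∫ y, φ (x * y⁻¹) ∂μ = 1 := fun x => by
    rw [← integral_mul_right_eq_self _ x]
    simp only [mul_inv_rev, mul_inv_cancel_left]
    change ∫ y, c⁻¹ * χ y⁻¹ ∂μ = 1
    rw [integral_const_mul]
    exact inv_mul_cancel₀ hint.ne'
  refine ⟨φ, fun x => by simp [φ, χ, mul_comm], ?_⟩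
  refine (ContinuousMap.norm_le _ hε.le).2 fun x => ?_
  have hcont : ∀ h : G → ℂ, Continuous h → Integrable h μ := fun h hh =>
    hh.integrable_of_hasCompactSupport (HasCompactSupport.of_compactSpace _)
  have heq : (convolutionOperator μ φ (ContinuousMap.toLp 2 μ ℂ f) - f) x =
      ∫ y, (f y - f x) * (φ (x * y⁻¹) : ℂ) ∂μ := by
    rw [ContinuousMap.sub_apply, convolutionOperator_toLp]
    simp only [sub_mul]
    rw [integral_sub (hcont _ (by fun_prop)) (hcont _ (by fun_prop)), integral_const_mul,
      integral_complex_ofReal, hφ1, Complex.ofReal_one, mul_one]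
  rw [heq]
  calc ‖∫ y, (f y - f x) * (φ (x * y⁻¹) : ℂ) ∂μ‖ ≤ ∫ y, ε * φ (x * y⁻¹) ∂μ := by
        refine norm_integral_le_of_norm_le ?_ (.of_forall fun y => ?_)
        · exact Continuous.integrable_of_hasCompactSupport (by fun_prop)
            (HasCompactSupport.of_compactSpace _)
        · rw [norm_mul, Complex.norm_real, Real.norm_of_nonneg (hφ0 _)]
          by_cases hy : x * y⁻¹ ∈ U
          · refine mul_le_mul_of_nonneg_right ?_ (hφ0 _)
            have h := ContinuousMap.dist_apply_le_dist (f := F (x * y⁻¹)) (g := F 1) x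
            have h' : F (x * y⁻¹) x = f y := by simp [F]
            rw [h', hF, dist_eq_norm] at h
            exact h.trans (le_of_lt (by rw [← hF]; exact hy))
          · simp [hφU _ hy]
    _ = ε := by rw [integral_const_mul, hφ1, mul_one]

end Convolution

/-- The Peter-Weyl theorem: the linear combinations of matrix coefficients of irreducible unitary
representations of a compact group are uniformly dense in the continuous functions. -/
theorem topologicalClosure_span_matrixCoefficients (G : Type*) [Group G] [TopologicalSpace G]
    [IsTopologicalGroup G] [CompactSpace G] [T2Space G] :
    (Submodule.span ℂ (matrixCoefficients G)).topologicalClosure = ⊤ := by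
  borelize G
  -- Haar measure is left invariant; its image under inversion is right invariant.
  let μ := (Measure.haar (G := G)).inv
  refine eq_top_iff.2 fun f _ => ?_
  rw [← SetLike.mem_coe, ← (Submodule.isClosed_topologicalClosure _).closure_eq,
    Metric.mem_closure_iff]
  intro ε hε
  obtain ⟨φ, hφ, h⟩ := exists_convolutionOperator_sub_lt μ f (half_pos hε)
  refine ⟨_, convolutionOperator_mem_closure μ φ hφ (ContinuousMap.toLp 2 μ ℂ f), ?_⟩
  rw [dist_comm, dist_eq_norm]
  linarith

/-- Inner regularity gives a compact `K` carrying nearly all the mass, and `K * τ' ⊆ U` persists for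
`τ'` near `τ`. This supplies the measurability of the convolution kernel. -/
lemma lowerSemicontinuous_measure_translate {G : Type*} [Group G] [TopologicalSpace G]
    [IsTopologicalGroup G] [MeasurableSpace G] (μ : Measure G) [μ.Regular] {U : Set G} (hU : IsOpen U) :
    LowerSemicontinuous fun τ => μ ((· * τ) ⁻¹' U) := by
  intro τ c hc
  obtain ⟨K, hKU, hK, hcK⟩ :=
    (hU.preimage (continuous_mul_const τ)).exists_lt_isCompact (μ := μ) hc
  have h : ∀ᶠ τ' in 𝓝 τ, ∀ ρ ∈ K, ρ * τ' ∈ U := by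
    refine hK.eventually_forall_of_forall_eventually fun ρ hρ => ?_
    have : Tendsto (fun q : G × G => q.2 * q.1) (𝓝 (τ, ρ)) (𝓝 (ρ * τ)) :=
      Continuous.tendsto (f := fun q : G × G => q.2 * q.1) (by fun_prop) (τ, ρ)
    exact this (hU.mem_nhds (hKU hρ))
  filter_upwards [h] with τ' hτ'
  exact hcK.trans_le (measure_mono hτ')

/-! ### From continuous functions to Borel functions by regularity. -/

section Measure

variable {G : Type*} [Group G] [TopologicalSpace G] [IsTopologicalGroup G]
  [MeasurableSpace G] [BorelSpace G]

/-- The Markov kernel sending `τ` to the distribution of `ρ * τ`, where `ρ` has distribution `μ`. -/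
noncomputable def translateKernel (μ : Measure G) [IsProbabilityMeasure μ] [μ.Regular] :
    Kernel G G where
  toFun τ := μ.map (· * τ)
  measurable' := by
    have (τ : G) : IsProbabilityMeasure (μ.map (· * τ)) :=
      Measure.isProbabilityMeasure_map (by fun_prop)
    refine Measurable.measure_of_isPiSystem_of_isProbabilityMeasure
      (BorelSpace.measurable_eq.trans borel_eq_generateFrom_isClosed) ?_ ?_
    · exact isPiSystem_isClosed
    · intro s hs
      have h : ∀ τ, μ.map (· * τ) s = 1 - μ ((· * τ) ⁻¹' sᶜ) := fun τ => by
        rw [Measure.map_apply (by fun_prop) hs.measurableSet, Set.preimage_compl,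
          prob_compl_eq_one_sub (measurable_mul_const τ hs.measurableSet),
          ENNReal.sub_sub_cancel (by simp) prob_le_one]
      simp only [h]
      exact measurable_const.sub
        (lowerSemicontinuous_measure_translate μ hs.isOpen_compl).measurable

instance (μ : Measure G) [IsProbabilityMeasure μ] [μ.Regular] :
    IsMarkovKernel (translateKernel μ) :=
  ⟨fun _ => Measure.isProbabilityMeasure_map (by fun_prop)⟩

lemma translateKernel_apply (μ : Measure G) [IsProbabilityMeasure μ] [μ.Regular] (τ : G)
    {s : Set G} (hs : MeasurableSet s) : translateKernel μ τ s = μ ((· * τ) ⁻¹' s) :=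
  Measure.map_apply (by fun_prop) hs

variable [CompactSpace G] {𝕜 : Type*} [RCLike 𝕜]

lemma ContinuousMap.integrable_of_compactSpace {X E : Type*} [TopologicalSpace X] [CompactSpace X]
    [MeasurableSpace X] [BorelSpace X] [NormedAddCommGroup E] (μ : Measure X) [IsFiniteMeasure μ]
    (f : C(X, E)) : Integrable f μ :=
  f.continuous.integrable_of_hasCompactSupport (HasCompactSupport.of_compactSpace _)

/-- Integration of continuous functions against a probability measure. -/
noncomputable def integralContinuousMap (𝕜 : Type*) [RCLike 𝕜] {X : Type*} [TopologicalSpace X]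
    [CompactSpace X] [MeasurableSpace X] [BorelSpace X] (μ : Measure X) [IsProbabilityMeasure μ] :
    C(X, 𝕜) →L[𝕜] 𝕜 :=
  LinearMap.mkContinuous
    { toFun := fun f => ∫ x, f x ∂μ
      map_add' := fun f g => integral_add (f.integrable_of_compactSpace μ)
        (g.integrable_of_compactSpace μ)
      map_smul' := fun c f => integral_smul c f } 1 fun f => by
    refine (norm_integral_le_of_norm_le_const (.of_forall f.norm_coe_le_norm)).trans ?_
    simp

/-- The continuous function `τ ↦ ∫ f (ρ * τ) ∂μ(ρ)`. -/
noncomputable def integralTranslate (𝕜 : Type*) [RCLike 𝕜] (μ : Measure G)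
    [IsProbabilityMeasure μ] : C(G, 𝕜) →L[𝕜] C(G, 𝕜) :=
  LinearMap.mkContinuous
    { toFun := fun f => ⟨fun τ => integralContinuousMap 𝕜 μ
        (ContinuousMap.curry ⟨fun q : G × G => f (q.2 * q.1), by fun_prop⟩ τ), by fun_prop⟩
      map_add' := fun f g => by
        ext τ
        exact integral_add
          (ContinuousMap.integrable_of_compactSpace μ ⟨fun ρ => f (ρ * τ), by fun_prop⟩)
          (ContinuousMap.integrable_of_compactSpace μ ⟨fun ρ => g (ρ * τ), by fun_prop⟩)
      map_smul' := fun c f => by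
        ext τ
        exact integral_smul c fun ρ => f (ρ * τ) } 1 fun f => by
    refine (ContinuousMap.norm_le _ (by positivity)).2 fun τ => ?_
    refine (norm_integral_le_of_norm_le_const
      (.of_forall fun ρ => f.norm_coe_le_norm (ρ * τ))).trans ?_
    simp

lemma integralTranslate_apply (μ : Measure G) [IsProbabilityMeasure μ] (f : C(G, 𝕜)) (τ : G) :
    integralTranslate 𝕜 μ f τ = ∫ ρ, f (ρ * τ) ∂μ := rfl

lemma exists_continuous_lt_integral_translate [T2Space G] (μ : Measure G) [IsProbabilityMeasure μ]
    [μ.Regular] {U : Set G} (hU : IsOpen U) (τ : G) {ε : ℝ} (hε : 0 < ε) :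
    ∃ f : C(G, ℝ), (∀ x, f x ≤ U.indicator 1 x) ∧
      μ.real ((· * τ) ⁻¹' U) < integralTranslate ℝ μ f τ + ε := by
  obtain ⟨K, hKU, hK, hcK⟩ : ∃ K ⊆ (· * τ) ⁻¹' U, IsCompact K ∧
      μ.real ((· * τ) ⁻¹' U) < μ.real K + ε := by
    have hV : IsOpen ((· * τ) ⁻¹' U) := hU.preimage (continuous_mul_const τ)
    -- Subtracting `ε` strictly lowers the measure only if it is nonzero.
    by_cases h0 : μ ((· * τ) ⁻¹' U) = 0
    · exact ⟨∅, Set.empty_subset _, isCompact_empty, by simpa [Measure.real, h0] using hε⟩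
    obtain ⟨K, hKU, hK, h⟩ := hV.exists_lt_isCompact (μ := μ)
      (ENNReal.sub_lt_self (measure_ne_top _ _) h0 (ENNReal.ofReal_pos.2 hε).ne')
    refine ⟨K, hKU, hK, ?_⟩
    have h' := ENNReal.lt_add_of_sub_lt_right (Or.inr ENNReal.ofReal_ne_top) h
    have h'' := (ENNReal.toReal_lt_toReal (measure_ne_top _ _)
      (ENNReal.add_ne_top.2 ⟨measure_ne_top _ _, ENNReal.ofReal_ne_top⟩)).2 h'
    rwa [ENNReal.toReal_add (measure_ne_top _ _) ENNReal.ofReal_ne_top,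
      ENNReal.toReal_ofReal hε.le] at h''
  have hKτ : IsClosed ((· * τ) '' K) := (hK.image (continuous_mul_const τ)).isClosed
  obtain ⟨f, hf0, hf1, hf⟩ := exists_continuous_zero_one_of_isClosed hU.isClosed_compl hKτ
    (Set.disjoint_left.2 fun x hx ⟨ρ, hρ, h⟩ => hx (h ▸ hKU hρ))
  refine ⟨f, fun x => ?_, hcK.trans_le ?_⟩
  · by_cases hx : x ∈ U
    · simpa [hx] using (hf x).2
    · simpa [hx] using (hf0 hx).le
  · gcongr
    rw [integralTranslate_apply, ← integral_indicator_one hK.isClosed.measurableSet]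
    refine integral_mono ((integrable_const 1).indicator hK.isClosed.measurableSet)
      (ContinuousMap.integrable_of_compactSpace μ ⟨fun ρ => f (ρ * τ), by fun_prop⟩) fun ρ => ?_
    by_cases hρ : ρ ∈ K
    · have : f (ρ * τ) = 1 := hf1 ⟨ρ, hρ, rfl⟩
      simp [hρ, this]
    · simpa [hρ] using (hf (ρ * τ)).1

/-- A Dini-type argument replaces monotone convergence, since the indicator of `U` need not be a
limit of a sequence of continuous functions. Vitali-Carathéodory puts an upper semicontinuous `g`
below the integrand; compactness then gives one continuous `f` below the indicator whose translate
integrals dominate `g` up to `ε`. -/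
lemma integral_measure_translate_le [T2Space G] (κ μ ν : Measure G) [IsProbabilityMeasure κ]
    [IsProbabilityMeasure μ] [IsProbabilityMeasure ν] [μ.Regular] [ν.Regular]
    (h : ∀ f : C(G, ℝ), ∫ ρ, f ρ ∂κ = ∫ τ, ∫ ρ, f (ρ * τ) ∂μ ∂ν) {U : Set G} (hU : IsOpen U) :
    ∫ τ, μ.real ((· * τ) ⁻¹' U) ∂ν ≤ κ.real U := by
  refine le_of_forall_pos_le_add fun δ hδ => ?_
  obtain ⟨ε, hε, rfl⟩ : ∃ ε > 0, ε + ε = δ := ⟨δ / 2, half_pos hδ, add_halves δ⟩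
  have hint : Integrable (fun τ => μ.real ((· * τ) ⁻¹' U)) ν := by
    refine Integrable.of_bound (C := 1)
      (lowerSemicontinuous_measure_translate μ hU).measurable.ennreal_toReal.aestronglyMeasurable
      (.of_forall fun τ => ?_)
    rw [Real.norm_of_nonneg measureReal_nonneg]
    exact measureReal_le_one
  obtain ⟨g, hgle, hgusc, hgint, hg⟩ := exists_upperSemicontinuous_le_integral_le
    (μ := ν) (fun τ => (μ ((· * τ) ⁻¹' U)).toNNReal) hint hε
  obtain ⟨f, hfU, hf⟩ : ∃ f : C(G, ℝ), (∀ x, f x ≤ U.indicator 1 x) ∧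
      ∀ τ ∈ Set.univ, (g τ : ℝ) ≤ integralTranslate ℝ μ f τ + ε := by
    -- Local choices of `f` are merged by taking suprema, which stay below the indicator.
    refine isCompact_univ.induction_on (p := fun s => ∃ f : C(G, ℝ),
      (∀ x, f x ≤ U.indicator 1 x) ∧ ∀ τ ∈ s, (g τ : ℝ) ≤ integralTranslate ℝ μ f τ + ε) ?_ ?_ ?_ ?_
    · exact ⟨0, fun x => Set.indicator_nonneg (fun _ _ => zero_le_one) x, by simp⟩
    · rintro s t hst ⟨f, h1, h2⟩
      exact ⟨f, h1, fun τ hτ => h2 τ (hst hτ)⟩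
    · rintro s t ⟨f, h1, h2⟩ ⟨f', h1', h2'⟩
      have hmono : ∀ (u v : C(G, ℝ)) τ, u ≤ v →
          integralTranslate ℝ μ u τ ≤ integralTranslate ℝ μ v τ := fun u v τ huv =>
        integral_mono
          (ContinuousMap.integrable_of_compactSpace μ ⟨fun ρ => u (ρ * τ), by fun_prop⟩)
          (ContinuousMap.integrable_of_compactSpace μ ⟨fun ρ => v (ρ * τ), by fun_prop⟩)
          fun ρ => huv (ρ * τ)
      refine ⟨f ⊔ f', fun x => sup_le (h1 x) (h1' x), ?_⟩
      rintro τ (hτ | hτ)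
      · exact (h2 τ hτ).trans (add_le_add_left (hmono _ _ τ le_sup_left) ε)
      · exact (h2' τ hτ).trans (add_le_add_left (hmono _ _ τ le_sup_right) ε)
    · intro τ _
      obtain ⟨f, h1, h2⟩ := exists_continuous_lt_integral_translate μ hU τ hε
      have hg' : UpperSemicontinuous fun τ => (g τ : ℝ) :=
        NNReal.continuous_coe.comp_upperSemicontinuous hgusc fun _ _ h => h
      have husc := hg'.add (integralTranslate ℝ μ f).continuous.neg.upperSemicontinuous
      have hτ : (g τ : ℝ) + -integralTranslate ℝ μ f τ < ε := by
        have : (g τ : ℝ) ≤ μ.real ((· * τ) ⁻¹' U) := hgle τ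
        linarith
      refine ⟨_, mem_nhdsWithin_of_mem_nhds (husc τ ε hτ), f, h1, fun τ' hτ' => ?_⟩
      have : (g τ' : ℝ) + -integralTranslate ℝ μ f τ' < ε := hτ'
      linarith
  have h1 : ∫ τ, (g τ : ℝ) ∂ν ≤ ∫ τ, (integralTranslate ℝ μ f τ + ε) ∂ν :=
    integral_mono hgint ((ContinuousMap.integrable_of_compactSpace ν _).add (integrable_const ε))
      fun τ => hf τ trivial
  rw [integral_add (ContinuousMap.integrable_of_compactSpace ν _) (integrable_const ε),
    integral_const, probReal_univ, one_smul] at h1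
  have h2 : ∫ τ, integralTranslate ℝ μ f τ ∂ν = ∫ ρ, f ρ ∂κ := (h f).symm
  have h3 : ∫ ρ, f ρ ∂κ ≤ κ.real U := by
    rw [← integral_indicator_one hU.measurableSet]
    exact integral_mono (f.integrable_of_compactSpace κ)
      ((integrable_const 1).indicator hU.measurableSet) hfU
  have h4 : ∫ τ, μ.real ((· * τ) ⁻¹' U) ∂ν - ε ≤ ∫ τ, (g τ : ℝ) ∂ν := hg
  linarith

/-- A regular measure which acts on continuous functions as the convolution of `μ` and `ν` is the
convolution of `μ` and `ν`. -/
lemma isConvolution_of_continuous [T2Space G] (κ μ ν : Measure G) [IsProbabilityMeasure κ]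
    [IsProbabilityMeasure μ] [IsProbabilityMeasure ν] [κ.Regular] [μ.Regular] [ν.Regular]
    (h : ∀ f : C(G, ℝ), ∫ ρ, f ρ ∂κ = ∫ τ, ∫ ρ, f (ρ * τ) ∂μ ∂ν) : IsConvolution κ μ ν := by
  let κ' : Measure G := (translateKernel μ ∘ₖ Kernel.const Unit ν) ()
  have hκ' : ∀ U, IsOpen U → κ' U ≤ κ U := fun U hU => by
    have h1 : κ' U = ∫⁻ τ, μ ((· * τ) ⁻¹' U) ∂ν := by
      rw [Kernel.comp_apply' _ _ _ hU.measurableSet, Kernel.const_apply]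
      exact lintegral_congr fun τ => translateKernel_apply μ τ hU.measurableSet
    rw [← ENNReal.toReal_le_toReal (measure_ne_top _ _) (measure_ne_top _ _), h1,
      ← integral_toReal
        (lowerSemicontinuous_measure_translate μ hU).measurable.aemeasurable
        (.of_forall fun τ => measure_lt_top _ _)]
    exact integral_measure_translate_le κ μ ν h hU
  have heq : κ' = κ := by
    -- Only the outer regularity of `κ` is used to pass from open to Borel sets.
    refine Measure.eq_of_le_of_isProbabilityMeasure (Measure.le_intro fun s _ _ => ?_)
    rw [s.measure_eq_iInf_isOpen κ]
    exact le_iInf₂ fun U hsU => le_iInf fun hU => (measure_mono hsU).trans (hκ' U hU)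
  rintro f hf ⟨C, hC⟩
  have hint : Integrable f κ' := Integrable.of_bound hf.aestronglyMeasurable C (.of_forall hC)
  rw [← heq]
  refine (Kernel.integral_comp hint).trans (integral_congr_ae (.of_forall fun τ => ?_))
  exact integral_map (by fun_prop) hf.aestronglyMeasurable

lemma IsConvolution.integral_continuous [T2Space G] {κ μ ν : Measure G} [IsProbabilityMeasure κ]
    [IsProbabilityMeasure μ] [IsProbabilityMeasure ν] (h : IsConvolution κ μ ν) (f : C(G, ℂ)) :
    ∫ ρ, f ρ ∂κ = ∫ τ, ∫ ρ, f (ρ * τ) ∂μ ∂ν := by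
  have hmain : ∀ L : ℂ →L[ℝ] ℝ, L (∫ ρ, f ρ ∂κ) = L (∫ τ, ∫ ρ, f (ρ * τ) ∂μ ∂ν) := fun L => by
    have hL := L.integral_comp_comm ((integralTranslate ℂ μ f).integrable_of_compactSpace ν)
    simp only [integralTranslate_apply] at hL
    rw [← L.integral_comp_comm (f.integrable_of_compactSpace κ), ← hL]
    refine (h (fun x => L (f x)) (by fun_prop) ⟨‖L‖ * ‖f‖, fun x => ?_⟩).trans
      (integral_congr_ae (.of_forall fun τ => ?_))
    · exact L.le_opNorm_of_le (f.norm_coe_le_norm x)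
    · exact L.integral_comp_comm
        (ContinuousMap.integrable_of_compactSpace μ ⟨fun ρ => f (ρ * τ), by fun_prop⟩)
  exact Complex.ext (hmain Complex.reCLM) (hmain Complex.imCLM)

end Measure

/-! ### Vague continuity from the Feller property. -/

section Feller

variable {E : Type*} [TopologicalSpace E] [MeasurableSpace E] [BorelSpace E]
  {p : ℝ≥0 → Kernel E E}

lemma IsFeller.isMarkovKernel (hp : IsFeller p) (t : ℝ≥0) : IsMarkovKernel (p t) :=
  ⟨hp.isProbabilityMeasure t⟩

lemma IsFeller.comp_eq (hp : IsFeller p) (s t : ℝ≥0) : p (s + t) = p t ∘ₖ p s := by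
  ext x A hA
  rw [hp.chapman_kolmogorov s t x A hA, Kernel.comp_apply' _ _ _ hA]

lemma IsFeller.integral_add [CompactSpace E] (hp : IsFeller p) (s t : ℝ≥0) (x : E) (f : C(E, ℝ)) :
    ∫ y, f y ∂(p (s + t) x) = ∫ y, transitionOperator (p t) f y ∂(p s x) := by
  have := hp.isMarkovKernel
  rw [hp.comp_eq]
  exact Kernel.integral_comp (f.integrable_of_compactSpace _)

/-- The increment from `s` to `s + h` is the integral of `T_h f - f` against `p s x`, at most `‖T_h
f - f‖` uniformly in `s`. This gives continuity from both sides. -/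
lemma IsFeller.continuous_integral [CompactSpace E] (hp : IsFeller p) (x : E) {f : E → ℝ}
    (hf : Continuous f) : Continuous fun t => ∫ y, f y ∂(p t x) := by
  have := hp.isMarkovKernel
  let f₀ : C₀(E, ℝ) := ⟨⟨f, hf⟩, by simp⟩
  have hdist : ∀ s h : ℝ≥0, ∀ ε : ℝ, (∀ y, dist (f y) (transitionOperator (p h) f y) < ε) →
      dist (∫ y, f y ∂(p (s + h) x)) (∫ y, f y ∂(p s x)) ≤ ε := fun s h ε hε => by
    obtain ⟨k, hk⟩ := hp.map_zeroAtInfty h f₀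
    have hkc : Continuous (transitionOperator (p h) f) := hk ▸ k.continuous
    have hadd : ∫ y, f y ∂(p (s + h) x) = ∫ y, transitionOperator (p h) f y ∂(p s x) :=
      hp.integral_add s h x ⟨f, hf⟩
    have hint : ∀ u : E → ℝ, Continuous u → Integrable u (p s x) := fun u hu =>
      ContinuousMap.integrable_of_compactSpace _ ⟨u, hu⟩
    rw [hadd, dist_eq_norm, ← integral_sub (hint _ hkc) (hint _ hf)]
    refine (norm_integral_le_of_norm_le_const (.of_forall fun y => ?_)).trans
      (by rw [probReal_univ, mul_one])
    rw [← dist_eq_norm, dist_comm]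
    exact (hε y).le
  refine Metric.continuous_iff.2 fun t ε hε => ?_
  have hu := Metric.tendstoUniformly_iff.1 (hp.tendsto_zero f₀) (ε / 2) (half_pos hε)
  obtain ⟨δ, hδ, hball⟩ := Metric.mem_nhdsWithin_iff.1 hu
  have hsmall : ∀ h : ℝ≥0, (h : ℝ) < δ →
      ∀ y, dist (f y) (transitionOperator (p h) f y) < ε / 2 := fun h hh y => by
    -- The filter `𝓝[>] 0` omits `h = 0`, where `T_0` is the identity.
    rcases eq_or_ne h 0 with rfl | h0
    · rw [transitionOperator, hp.zero y, integral_dirac' _ _ hf.stronglyMeasurable, dist_self]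
      exact half_pos hε
    · exact hball ⟨by simpa [NNReal.dist_eq] using hh, pos_iff_ne_zero.2 h0⟩ y
  refine ⟨δ, hδ, fun s hs => ?_⟩
  rw [NNReal.dist_eq, abs_lt] at hs
  rcases le_total t s with hts | hst
  · have h := hdist t (s - t) _ (hsmall _ (by rw [NNReal.coe_sub hts]; exact hs.2))
    rw [add_tsub_cancel_of_le hts] at h
    linarith
  · have h := hdist s (t - s) _ (hsmall _ (by rw [NNReal.coe_sub hst]; linarith))
    rw [add_tsub_cancel_of_le hst, dist_comm] at h
    linarith

end Feller

/-! ### Symbols at the identity as Fourier transforms. -/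

section Symbol

variable {G : Type*} [Group G] [TopologicalSpace G]

lemma IrreducibleUnitaryRep.continuous_matrix (π : IrreducibleUnitaryRep G) :
    Continuous π.matrix :=
  continuous_subtype_val.comp π.continuous_toHom

lemma IrreducibleUnitaryRep.matrix_mul (π : IrreducibleUnitaryRep G) (g h : G) :
    π.matrix (g * h) = π.matrix g * π.matrix h := by
  simp [IrreducibleUnitaryRep.matrix]

lemma symbol_one (A : (G → ℂ) → (G → ℂ)) (π : IrreducibleUnitaryRep G) :
    symbol A 1 π = Matrix.of fun i j => A (fun x => π.matrix x i j) 1 := by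
  simp [symbol, IrreducibleUnitaryRep.matrix]

variable [CompactSpace G] [MeasurableSpace G] [BorelSpace G]

lemma integral_integral_matrix_mul (π : IrreducibleUnitaryRep G) (μ ν : Measure G)
    [IsProbabilityMeasure μ] [IsProbabilityMeasure ν] (i j : Fin π.dim) :
    ∫ τ, ∫ ρ, π.matrix (ρ * τ) i j ∂μ ∂ν =
      ∑ k, (∫ ρ, π.matrix ρ i k ∂μ) * ∫ τ, π.matrix τ k j ∂ν := by
  have hint : ∀ (η : Measure G) [IsProbabilityMeasure η] (k l : Fin π.dim),
      Integrable (fun x => π.matrix x k l) η := fun η _ k l =>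
    ContinuousMap.integrable_of_compactSpace η ⟨_, π.continuous_matrix.matrix_elem k l⟩
  simp only [π.matrix_mul, Matrix.mul_apply]
  have h : ∀ τ, ∫ ρ, ∑ k, π.matrix ρ i k * π.matrix τ k j ∂μ =
      ∑ k, (∫ ρ, π.matrix ρ i k ∂μ) * π.matrix τ k j := fun τ => by
    rw [integral_finsetSum _ fun k _ => (hint μ i k).mul_const _]
    simp only [integral_mul_const]
  simp only [h]
  rw [integral_finsetSum _ fun k _ => (hint ν k j).const_mul _]
  simp only [integral_const_mul]

/-- If `κ` and the convolution of `μ` and `ν` agree on matrix coefficients, then they agree on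
continuous functions. -/
lemma integral_eq_of_matrixCoefficients [IsTopologicalGroup G] [T2Space G] (κ μ ν : Measure G)
    [IsProbabilityMeasure κ] [IsProbabilityMeasure μ] [IsProbabilityMeasure ν]
    (h : ∀ (π : IrreducibleUnitaryRep G) i j, ∫ ρ, π.matrix ρ i j ∂κ =
      ∫ τ, ∫ ρ, π.matrix (ρ * τ) i j ∂μ ∂ν) (f : C(G, ℂ)) :
    ∫ ρ, f ρ ∂κ = ∫ τ, ∫ ρ, f (ρ * τ) ∂μ ∂ν := by
  have heq : integralContinuousMap ℂ κ =
      (integralContinuousMap ℂ ν).comp (integralTranslate ℂ μ) := by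
    refine ContinuousLinearMap.ext_on (s := matrixCoefficients G) ?_ ?_
    · rw [Submodule.dense_iff_topologicalClosure_eq_top]
      exact topologicalClosure_span_matrixCoefficients G
    · rintro f ⟨π, i, j, hf⟩
      change ∫ ρ, f ρ ∂κ = ∫ τ, ∫ ρ, f (ρ * τ) ∂μ ∂ν
      simp only [hf]
      exact h π i j
  exact congrArg (fun Λ => Λ f) heq

end Symbol

theorem mainTheorem4 {G : Type*} [Group G] [TopologicalSpace G] [IsTopologicalGroup G]
    [CompactSpace G] [T2Space G] [MeasurableSpace G] [BorelSpace G]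
    (p : ℝ≥0 → Kernel G G) (hp : IsFeller p) :
    (∀ (π : IrreducibleUnitaryRep G) (s t : ℝ≥0),
      symbol (transitionOperator (p (s + t))) 1 π =
        symbol (transitionOperator (p s)) 1 π * symbol (transitionOperator (p t)) 1 π) ↔
    IsConvolutionSemigroup (fun t => p t 1) := by
  have hprob := hp.isProbabilityMeasure
  have hreg := hp.regular
  have hsymbol : ∀ (π : IrreducibleUnitaryRep G) (s t : ℝ≥0),
      symbol (transitionOperator (p (s + t))) 1 π =
        symbol (transitionOperator (p s)) 1 π * symbol (transitionOperator (p t)) 1 π ↔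
      ∀ i j, ∫ ρ, π.matrix ρ i j ∂(p (s + t) 1) =
        ∫ τ, ∫ ρ, π.matrix (ρ * τ) i j ∂(p s 1) ∂(p t 1) := fun π s t => by
    simp only [← Matrix.ext_iff, symbol_one, Matrix.mul_apply, Matrix.of_apply,
      integral_integral_matrix_mul]
    rfl
  simp only [hsymbol]
  refine ⟨fun h => ⟨fun t => hprob t 1, fun t => hreg t 1, hp.zero 1, fun s t => ?_,
    fun f hf _ => hp.continuous_integral 1 hf⟩, fun h π s t i j => ?_⟩
  · refine isConvolution_of_continuous _ _ _ fun f => ?_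
    have hf := integral_eq_of_matrixCoefficients _ _ _ (fun π => h π s t)
      ⟨fun x => (f x : ℂ), by fun_prop⟩
    simp only [ContinuousMap.coe_mk, integral_complex_ofReal] at hf
    exact_mod_cast hf
  · exact (h.add s t).integral_continuous ⟨_, π.continuous_matrix.matrix_elem i j⟩
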